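/- \textbf{Lemma (mutual-information lower bound).} Let $n, m \ge 0$ and $d\ge 1$ be integers. Let $\mathbf Z$ be a random matrix with values in $\mathbb C^{n\times d}$ whose columns $\mathbf z_{:1},\dots,\mathbf z_{:d}$ are independent and identically distributed with the circularly symmetric complex normal law $\mathcal{CN}(\boldsymbol\mu,\mathbf P)$, where $\boldsymbol\mu\in\mathbb C^n$ and $\mathbf P\in\mathbb C^{n\times n}$ is Hermitian positive definite; that is, the real and imaginary parts of $\mathbf z_{:i}$ are jointly Gaussian, $\mathbb E[\mathbf z_{:i}]=\boldsymbol\mu$, $\mathbb E[(\mathbf z_{:i}-\boldsymbol\mu)(\mathbf z_{:i}-\boldsymbol\mu)^{\mathsf H}]=\mathbf P$ and $\mathbb E[(\mathbf z_{:i}-\boldsymbol\mu)(\mathbf z_{:i}-\boldsymbol\mu)^{\mathsf T}]=0$. Let $\mathbf Y$ be any random matrix on the same probability space, with values in $\mathbb C^{m\times d}$, columns $\mathbf y_{:1},\dots,\mathbf y_{:d}$ and square-integrable entries. Put $\overline{\mathbf Z}=\mathbf Z-\mathbb E[\mathbf Z]$ and $\overline{\mathbf Y}=\mathbf Y-\mathbb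 E[\mathbf Y]$, assume that $\mathbb E[\overline{\mathbf y}_{:i}\overline{\mathbf y}_{:i}^{\mathsf H}]$ is invertible for every $i$, and define \[ \mathbf C_i=\mathbb E[\overline{\mathbf z}_{:i}\overline{\mathbf y}_{:i}^{\mathsf H}]\;\mathbb E[\overline{\mathbf y}_{:i}\overline{\mathbf y}_{:i}^{\mathsf H}]^{-1}\;\mathbb E[\overline{\mathbf y}_{:i}\overline{\mathbf z}_{:i}^{\mathsf H}],\qquad \mathbf P_C=\mathbf P^{-1}\,\frac1d\sum_{i=1}^d\mathbf C_i . \] Then the determinant $|\mathbf I-\mathbf P_C|$ is a nonnegative real number, and the mutual information of $\mathbf Z$ and $\mathbf Y$ (in nats, that is, the Kullback--Leibler divergence of the joint law of $(\mathbf Z,\mathbf Y)$ from the product of the laws of $\mathbf Z$ and $\mathbf Y$, a value in $[0,\infty]$) satisfies \[ I(\mathbf Z;\mathbf Y)\;\ge\;-d\,\ln|\mathbf I-\mathbf P_C| , \] where $\ln 0=-\infty$, so that $I(\mathbf Z;\mathbf Y)=\infty$ if $|\mathbf I-\mathbf P_C|=0$. -/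

import Mathlib

open MeasureTheory ProbabilityTheory
open scoped ENNReal ComplexConjugate ComplexOrder

noncomputable section

/-- The cross-covariance matrix `E[ū v̄ᴴ]` of two complex random vectors `u`, `v`,
where `ū = u - E[u]` and `v̄ = v - E[v]`. -/
def crossCov {Ω : Type*} [MeasurableSpace Ω] {m n : ℕ} (u : Ω → Fin m → ℂ) (v : Ω → Fin n → ℂ)
    (Q : Measure Ω) : Matrix (Fin m) (Fin n) ℂ :=
  Matrix.of fun a b =>
    ∫ ω, (u ω a - ∫ ω', u ω' a ∂Q) * conj (v ω b - ∫ ω', v ω' b ∂Q) ∂Q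

/-- `X` has the (circularly symmetric) complex normal law `CN(μ, P)`: its real and imaginary parts
are jointly Gaussian, its mean is `μ`, its covariance `E[(X - μ)(X - μ)ᴴ]` is `P`, and its
pseudo-covariance `E[(X - μ)(X - μ)ᵀ]` vanishes. Here `Fin n → ℂ` is regarded as a real vector
space in `HasGaussianLaw`. -/
structure HasComplexGaussianLaw {Ω : Type*} [MeasurableSpace Ω] {n : ℕ} (X : Ω → Fin n → ℂ)
    (μ : Fin n → ℂ) (P : Matrix (Fin n) (Fin n) ℂ) (Q : Measure Ω) : Prop where
  gaussian : HasGaussianLaw X Q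
  mean : ∀ a, ∫ ω, X ω a ∂Q = μ a
  cov : ∀ a b, ∫ ω, (X ω a - μ a) * conj (X ω b - μ b) ∂Q = P a b
  pseudoCov : ∀ a b, ∫ ω, (X ω a - μ a) * (X ω b - μ b) ∂Q = 0

/-- The mutual information `I(X; Y)`, in nats and with values in `[0, ∞]`, of two complex random
matrices: the Kullback-Leibler divergence of their joint law from the product of their laws.
`Matrix.of.symm` views a matrix as its array of entries, which carries the product σ-algebra. -/
def mutualInfo {Ω : Type*} [MeasurableSpace Ω] {n m d : ℕ}
    (X : Ω → Matrix (Fin n) (Fin d) ℂ) (Y : Ω → Matrix (Fin m) (Fin d) ℂ)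
    (Q : Measure Ω) : ℝ≥0∞ :=
  InformationTheory.klDiv
    (Q.map fun ω => (Matrix.of.symm (X ω), Matrix.of.symm (Y ω)))
    ((Q.map fun ω => Matrix.of.symm (X ω)).prod (Q.map fun ω => Matrix.of.symm (Y ω)))

/-- The covariance of the column `z_i` explained by the linear minimum mean square error estimator
from the column `y_i`: `C_i = E[z̄_i ȳ_iᴴ] E[ȳ_i ȳ_iᴴ]⁻¹ E[ȳ_i z̄_iᴴ]`. -/
def explainedCov {Ω : Type*} [MeasurableSpace Ω] {n m d : ℕ}
    (Z : Ω → Matrix (Fin n) (Fin d) ℂ) (Y : Ω → Matrix (Fin m) (Fin d) ℂ)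
    (Q : Measure Ω) (i : Fin d) : Matrix (Fin n) (Fin n) ℂ :=
  crossCov (fun ω => (Z ω).col i) (fun ω => (Y ω).col i) Q *
    (crossCov (fun ω => (Y ω).col i) (fun ω => (Y ω).col i) Q)⁻¹ *
    crossCov (fun ω => (Y ω).col i) (fun ω => (Z ω).col i) Q

/-- `P_C = P⁻¹ (1/d) ∑ᵢ C_i`. -/
def corrMatrix {Ω : Type*} [MeasurableSpace Ω] {n m d : ℕ}
    (P : Matrix (Fin n) (Fin n) ℂ)
    (Z : Ω → Matrix (Fin n) (Fin d) ℂ) (Y : Ω → Matrix (Fin m) (Fin d) ℂ)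
    (Q : Measure Ω) : Matrix (Fin n) (Fin n) ℂ :=
  P⁻¹ * ((1 / (d : ℂ)) • ∑ i, explainedCov Z Y Q i)

end

/-!
Mutual-information lower bound for a matrix with independent circularly symmetric Gaussian columns.

The divergence of the joint law from the product law is bounded below by the Donsker-Varadhan
inequality, `klDiv π ν ≥ ∫ f ∂π` whenever `∫ exp f ∂ν = 1`
(`integral_le_klDiv_of_lintegral_exp_eq_one`). The test function `f` is the log-ratio between a
Gaussian prediction of `Z` from `Y` and the law of `Z`. The prediction is centred at the linear
minimum mean square error estimator of each column, and its error covariance is the same for all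
columns. No property of the law of `Y` beyond its second moments enters, because for each fixed
value of `Y` the function `exp f` is a ratio of Gaussian densities and so has integral one.

Put `R = P - (1/d) ∑ C_i`, the error covariance of the estimators averaged over the columns. It is
Hermitian and `P` is positive definite, so there is `T` with `T P Tᴴ = 1` and `T R Tᴴ = diag ρ`
(`Matrix.PosDef.exists_congruence_diagonal`). Then `det (1 - P_C) = det (P⁻¹ R) = ∏ ρ k`, and `ρ k`
is a mean of error variances, hence nonnegative. Circular symmetry makes the real and imaginary
parts of the coordinates of `T (z_i - μ)` independent real Gaussians of variance `1/2`
(`iIndepFun_whitened`), so that the integral of `exp f` factors into one-dimensional Gaussian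
integrals (`lintegral_exp_quadratic_gaussianReal`).

With error variances `ρ k + ε`, `ε > 0`, in place of `ρ k`, the expectation of `f` is at least
`-d ∑ log (ρ k + ε)`. Letting `ε` tend to zero gives the bound, and treats the singular case
`∏ ρ k = 0` together with the regular one (`neg_mul_log_prod_le_of_forall_pos`).
-/

/-! ### A variational lower bound for the Kullback-Leibler divergence -/

/-- The easy half of the Donsker-Varadhan variational formula: the defect in the inequality is the
divergence of `μ` from the tilted measure `ν.tilted f`. -/
theorem integral_le_klDiv_of_lintegral_exp_eq_one {α : Type*} [MeasurableSpace α]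
    {μ ν : Measure α} [IsProbabilityMeasure μ] [IsProbabilityMeasure ν] {f : α → ℝ}
    (hf : Measurable f) (hfμ : Integrable f μ) (hfν : ∫⁻ x, ENNReal.ofReal (Real.exp (f x)) ∂ν = 1) :
    ((∫ x, f x ∂μ : ℝ) : EReal) ≤ (InformationTheory.klDiv μ ν : EReal) := by
  by_cases h : InformationTheory.klDiv μ ν = ∞
  · simp [h]
  obtain ⟨hac, hint⟩ := InformationTheory.klDiv_ne_top_iff.1 h
  have hexp : Integrable (fun x => Real.exp (f x)) ν := by
    refine ⟨by fun_prop, ?_⟩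
    rw [hasFiniteIntegral_iff_ofReal (Filter.Eventually.of_forall fun x => (Real.exp_pos _).le), hfν]
    exact ENNReal.one_lt_top
  have hone : ∫ x, Real.exp (f x) ∂ν = 1 := by
    rw [integral_eq_lintegral_of_nonneg_ae
      (Filter.Eventually.of_forall fun x => (Real.exp_pos _).le) (by fun_prop), hfν]
    simp
  have htilt := isProbabilityMeasure_tilted hexp
  have hac' : μ ≪ ν.tilted f := hac.trans (absolutelyContinuous_tilted hexp)
  have hnn := InformationTheory.integral_llr_add_sub_measure_univ_nonneg hac'
    (integrable_llr_tilted_right hac hfμ hint hexp)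
  rw [integral_llr_tilted_right hac hfμ hexp hint, hone] at hnn
  simp only [Real.log_one, probReal_univ] at hnn
  rw [← EReal.coe_toReal (x := (InformationTheory.klDiv μ ν : EReal)) (by simpa using h) (by simp),
    EReal.coe_le_coe_iff, EReal.toReal_coe_ennreal,
    InformationTheory.toReal_klDiv_of_measure_eq hac (by simp)]
  linarith

/-- The integrand is the density of `gaussianReal a (r / 2)` with respect to
`gaussianReal 0 (1 / 2)`. -/
theorem lintegral_exp_quadratic_gaussianReal {r : ℝ} (hr : 0 < r) (a : ℝ) :
    ∫⁻ x, ENNReal.ofReal (Real.exp (-(1 / 2) * Real.log r + x ^ 2 - (x - a) ^ 2 / r))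
      ∂(gaussianReal 0 (1 / 2)) = 1 := by
  have hr2 : (r / 2).toNNReal ≠ 0 := by simpa using hr
  rw [gaussianReal_of_var_ne_zero _ (by norm_num), lintegral_withDensity_eq_lintegral_mul _
    (measurable_gaussianPDF _ _) (by fun_prop), ← lintegral_gaussianPDFReal_eq_one a hr2]
  refine lintegral_congr fun x => ?_
  rw [Pi.mul_apply, gaussianPDF, ← ENNReal.ofReal_mul (gaussianPDFReal_nonneg _ _ _)]
  congr 1
  have hsq : Real.exp (-(1 / 2) * Real.log r) = (√r)⁻¹ := by
    rw [Real.sqrt_eq_rpow, ← Real.rpow_neg hr.le, Real.rpow_def_of_pos hr]; ring_nf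
  rw [add_sub_assoc, Real.exp_add, hsq, gaussianPDFReal_def, gaussianPDFReal_def]
  simp only [NNReal.coe_div, NNReal.coe_one, NNReal.coe_ofNat,
    Real.coe_toNNReal _ (half_pos hr).le]
  rw [show 2 * Real.pi * (1 / 2) = Real.pi by ring, show 2 * Real.pi * (r / 2) = Real.pi * r by ring,
    Real.sqrt_mul Real.pi_pos.le, mul_inv, mul_mul_mul_comm, mul_assoc _ (√r)⁻¹,
    mul_left_comm _ (√r)⁻¹, mul_assoc, ← Real.exp_add, mul_left_comm]
  congr 3
  field_simp
  ring

/-- A lower bound for the divergence of a coupling `π` from the product `κ.prod τ`, when `κ` has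
independent coordinates `φ i` with law `gaussianReal 0 (1 / 2)`. The test function in the
variational formula is the log-density, relative to the law of `φ i`, of a Gaussian predictor of
`φ i` with mean `ψ i` and variance `r i / 2`. -/
theorem integral_gaussian_test_le_klDiv {S T ι : Type*} [MeasurableSpace S] [MeasurableSpace T]
    [Fintype ι] (π : Measure (S × T)) [IsProbabilityMeasure π] (κ : Measure S)
    [IsProbabilityMeasure κ] (τ : Measure T) [IsProbabilityMeasure τ]
    {φ : ι → S → ℝ} {ψ : ι → T → ℝ} (hφ : ∀ i, Measurable (φ i)) (hψ : ∀ i, Measurable (ψ i))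
    (hindep : iIndepFun φ κ) (hlaw : ∀ i, κ.map (φ i) = gaussianReal 0 (1 / 2))
    {r : ι → ℝ} (hr : ∀ i, 0 < r i)
    (hφπ : ∀ i, Integrable (fun p : S × T => φ i p.1 ^ 2) π)
    (hφψπ : ∀ i, Integrable (fun p : S × T => (φ i p.1 - ψ i p.2) ^ 2) π) :
    ((∑ i, (-(1 / 2) * Real.log (r i) + ∫ p, φ i p.1 ^ 2 ∂π
      - (∫ p, (φ i p.1 - ψ i p.2) ^ 2 ∂π) / r i) : ℝ) : EReal) ≤
      (InformationTheory.klDiv π (κ.prod τ) : EReal) := by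
  have hint : ∀ i, Integrable (fun p : S × T => -(1 / 2) * Real.log (r i) + φ i p.1 ^ 2
      - (φ i p.1 - ψ i p.2) ^ 2 / r i) π := fun i =>
    ((integrable_const _).add (hφπ i)).sub ((hφψπ i).div_const _)
  have key := integral_le_klDiv_of_lintegral_exp_eq_one (μ := π) (ν := κ.prod τ)
    (f := fun p => ∑ i, (-(1 / 2) * Real.log (r i) + φ i p.1 ^ 2
      - (φ i p.1 - ψ i p.2) ^ 2 / r i)) (by fun_prop)
    (integrable_finsetSum _ fun i _ => hint i) ?_
  · rw [integral_finsetSum _ fun i _ => hint i] at key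
    convert! key using 4 with i
    rw [integral_sub (f := fun p : S × T => -(1 / 2) * Real.log (r i) + φ i p.1 ^ 2)
      ((integrable_const _).add (hφπ i)) ((hφψπ i).div_const _),
      integral_add (integrable_const _) (hφπ i), integral_div]
    simp
  -- For a fixed value of the second component, `exp` of the test function factors over `i`.
  · rw [lintegral_prod_symm' _ (by fun_prop)]
    have hinner : ∀ t, ∫⁻ s, ENNReal.ofReal (Real.exp (∑ i, (-(1 / 2) * Real.log (r i)
        + φ i s ^ 2 - (φ i s - ψ i t) ^ 2 / r i))) ∂κ = 1 := fun t => by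
      let g : ι → ℝ → ℝ≥0∞ := fun i x =>
        ENNReal.ofReal (Real.exp (-(1 / 2) * Real.log (r i) + x ^ 2 - (x - ψ i t) ^ 2 / r i))
      have hg : ∀ i, Measurable (g i) := fun i => by fun_prop
      have hprod := lintegral_prod_eq_prod_lintegral_of_indepFun Finset.univ
        (fun i s => g i (φ i s)) (hindep.comp g hg) fun i => (hg i).comp (hφ i)
      simp only [Real.exp_sum]
      simp_rw [ENNReal.ofReal_prod_of_nonneg (s := Finset.univ) fun i _ => (Real.exp_pos _).le]
      refine hprod.trans (Finset.prod_eq_one fun i _ => ?_)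
      rw [← lintegral_map (hg i) (hφ i), hlaw i]
      exact lintegral_exp_quadratic_gaussianReal (hr i) _
    simp only [hinner, lintegral_const, measure_univ, mul_one]

/-! ### Second-moment matrices -/

section SecondMoment

variable {Ω : Type*} [MeasurableSpace Ω] {Q : Measure Ω} {k l p q : ℕ}

/-- The second-moment matrix `E[u vᴴ]` of two complex random vectors. -/
noncomputable def secondMoment (u : Ω → Fin k → ℂ) (v : Ω → Fin l → ℂ) (Q : Measure Ω) :
    Matrix (Fin k) (Fin l) ℂ :=
  Matrix.of fun a b => ∫ ω, u ω a * conj (v ω b) ∂Q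

theorem MeasureTheory.MemLp.integrable_mul_conj {f g : Ω → ℂ} (hf : MemLp f 2 Q)
    (hg : MemLp g 2 Q) : Integrable (fun ω => f ω * conj (g ω)) Q :=
  hf.integrable_mul hg.star

theorem memLp_mulVec (B : Matrix (Fin p) (Fin k) ℂ) {u : Ω → Fin k → ℂ}
    (hu : ∀ a, MemLp (fun ω => u ω a) 2 Q) (a : Fin p) :
    MemLp (fun ω => (B.mulVec (u ω)) a) 2 Q := by
  simp only [Matrix.mulVec, dotProduct]
  exact memLp_finsetSum _ fun j _ => (hu j).const_mul _

theorem conjTranspose_secondMoment (u : Ω → Fin k → ℂ) (v : Ω → Fin l → ℂ) :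
    (secondMoment u v Q).conjTranspose = secondMoment v u Q := by
  ext a b
  simp only [secondMoment, Matrix.conjTranspose_apply, Matrix.of_apply]
  rw [RCLike.star_def, ← integral_conj]
  simp [mul_comm]

theorem secondMoment_mulVec_left (B : Matrix (Fin p) (Fin k) ℂ) {u : Ω → Fin k → ℂ}
    {v : Ω → Fin l → ℂ} (hu : ∀ a, MemLp (fun ω => u ω a) 2 Q)
    (hv : ∀ a, MemLp (fun ω => v ω a) 2 Q) :
    secondMoment (fun ω => B.mulVec (u ω)) v Q = B * secondMoment u v Q := by
  ext a b
  simp only [secondMoment, Matrix.mul_apply, Matrix.of_apply, Matrix.mulVec, dotProduct,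
    Finset.sum_mul, mul_assoc]
  rw [integral_finsetSum _ fun j _ => ((hu j).integrable_mul_conj (hv b)).const_mul _]
  simp only [integral_const_mul]

theorem secondMoment_mulVec_right (B : Matrix (Fin p) (Fin l) ℂ) {u : Ω → Fin k → ℂ}
    {v : Ω → Fin l → ℂ} (hu : ∀ a, MemLp (fun ω => u ω a) 2 Q)
    (hv : ∀ a, MemLp (fun ω => v ω a) 2 Q) :
    secondMoment u (fun ω => B.mulVec (v ω)) Q = secondMoment u v Q * B.conjTranspose := by
  rw [← conjTranspose_secondMoment, secondMoment_mulVec_left B hv hu, Matrix.conjTranspose_mul,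
    conjTranspose_secondMoment]

theorem secondMoment_sub_left {u u' : Ω → Fin k → ℂ} {v : Ω → Fin l → ℂ}
    (hu : ∀ a, MemLp (fun ω => u ω a) 2 Q) (hu' : ∀ a, MemLp (fun ω => u' ω a) 2 Q)
    (hv : ∀ a, MemLp (fun ω => v ω a) 2 Q) :
    secondMoment (fun ω => u ω - u' ω) v Q = secondMoment u v Q - secondMoment u' v Q := by
  ext a b
  simp only [secondMoment, Matrix.sub_apply, Matrix.of_apply, Pi.sub_apply, sub_mul]
  exact integral_sub ((hu a).integrable_mul_conj (hv b)) ((hu' a).integrable_mul_conj (hv b))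

theorem secondMoment_sub_right {u : Ω → Fin k → ℂ} {v v' : Ω → Fin l → ℂ}
    (hu : ∀ a, MemLp (fun ω => u ω a) 2 Q) (hv : ∀ a, MemLp (fun ω => v ω a) 2 Q)
    (hv' : ∀ a, MemLp (fun ω => v' ω a) 2 Q) :
    secondMoment u (fun ω => v ω - v' ω) Q = secondMoment u v Q - secondMoment u v' Q := by
  rw [← conjTranspose_secondMoment, secondMoment_sub_left hv hv' hu, Matrix.conjTranspose_sub,
    conjTranspose_secondMoment, conjTranspose_secondMoment]

/-- The error matrix of the linear minimum mean square error estimator of `u` from `v`. -/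
theorem secondMoment_sub_lmmse {u : Ω → Fin k → ℂ} {v : Ω → Fin l → ℂ}
    (hu : ∀ a, MemLp (fun ω => u ω a) 2 Q) (hv : ∀ a, MemLp (fun ω => v ω a) 2 Q)
    (hinv : IsUnit (secondMoment v v Q)) {A : Matrix (Fin k) (Fin l) ℂ}
    (hA : A = secondMoment u v Q * (secondMoment v v Q)⁻¹) :
    secondMoment (fun ω => u ω - A.mulVec (v ω)) (fun ω => u ω - A.mulVec (v ω)) Q =
      secondMoment u u Q
        - secondMoment u v Q * (secondMoment v v Q)⁻¹ * secondMoment v u Q := by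
  have hAv := memLp_mulVec A hv
  have hdet := (Matrix.isUnit_iff_isUnit_det _).1 hinv
  -- `E[u vᴴ] Aᴴ = A E[v uᴴ] = A E[v vᴴ] Aᴴ`, so three of the four terms collapse into one.
  have huAv : ∀ a, MemLp (fun ω => (u ω - A.mulVec (v ω)) a) 2 Q := fun a => (hu a).sub (hAv a)
  rw [secondMoment_sub_left hu hAv huAv,
    secondMoment_sub_right hu hu hAv, secondMoment_sub_right hAv hu hAv,
    secondMoment_mulVec_right A hu hv, secondMoment_mulVec_right A hAv hv,
    secondMoment_mulVec_left A hv hv, secondMoment_mulVec_left A hv hu, hA,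
    Matrix.nonsing_inv_mul_cancel_right _ _ hdet]
  abel

theorem crossCov_eq_secondMoment (u : Ω → Fin k → ℂ) (v : Ω → Fin l → ℂ) :
    crossCov u v Q = secondMoment (fun ω a => u ω a - ∫ ω', u ω' a ∂Q)
      (fun ω a => v ω a - ∫ ω', v ω' a ∂Q) Q := rfl

theorem secondMoment_self_apply_self {u : Ω → Fin k → ℂ} (a : Fin k)
    (hu : MemLp (fun ω => u ω a) 2 Q) :
    secondMoment u u Q a a =
      ((∫ ω, (u ω a).re ^ 2 ∂Q + ∫ ω, (u ω a).im ^ 2 ∂Q : ℝ) : ℂ) := by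
  have hre : Integrable (fun ω => (u ω a).re ^ 2) Q := hu.re.integrable_sq
  have him : Integrable (fun ω => (u ω a).im ^ 2) Q := hu.im.integrable_sq
  rw [← integral_add hre him, ← integral_complex_ofReal]
  refine integral_congr_ae (Filter.Eventually.of_forall fun ω => ?_)
  simp only [Complex.mul_conj, Complex.normSq_apply]
  push_cast
  simp [sq]

end SecondMoment

/-! ### Simultaneous diagonalization -/

open scoped MatrixOrder Matrix.Norms.L2Operator in
theorem Matrix.PosSemidef.exists_eq_conjTranspose_mul_self {n : ℕ} {P : Matrix (Fin n) (Fin n) ℂ}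
    (hP : P.PosSemidef) : ∃ B : Matrix (Fin n) (Fin n) ℂ, P = B.conjTranspose * B :=
  CStarAlgebra.nonneg_iff_eq_star_mul_self.1 hP.nonneg

/-- A positive definite and a Hermitian matrix are simultaneously diagonalized by a congruence. -/
theorem Matrix.PosDef.exists_congruence_diagonal {n : ℕ} {P R : Matrix (Fin n) (Fin n) ℂ}
    (hP : P.PosDef) (hR : R.IsHermitian) :
    ∃ (T : Matrix (Fin n) (Fin n) ℂ) (ρ : Fin n → ℝ), T * P * T.conjTranspose = 1 ∧
      T * R * T.conjTranspose = Matrix.diagonal fun k => (ρ k : ℂ) := by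
  obtain ⟨B, hB⟩ := hP.posSemidef.exists_eq_conjTranspose_mul_self
  have hBu : IsUnit B.det := by
    have h := hP.det_pos.ne'
    rw [hB, Matrix.det_mul] at h
    exact isUnit_iff_ne_zero.2 (right_ne_zero_of_mul h)
  have hBu' : IsUnit B.conjTranspose.det := by
    rw [Matrix.det_conjTranspose]; exact hBu.star
  have hS : (B.conjTranspose⁻¹ * R * B⁻¹).IsHermitian := by
    rw [Matrix.IsHermitian, Matrix.conjTranspose_mul, Matrix.conjTranspose_mul, hR.eq,
      Matrix.conjTranspose_nonsing_inv, Matrix.conjTranspose_nonsing_inv,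
      Matrix.conjTranspose_conjTranspose, Matrix.mul_assoc]
  let U : Matrix (Fin n) (Fin n) ℂ := hS.eigenvectorUnitary
  have hU : star U * U = 1 := Unitary.coe_star_mul_self hS.eigenvectorUnitary
  have hconj : (star U * B.conjTranspose⁻¹).conjTranspose = B⁻¹ * U := by
    rw [Matrix.conjTranspose_mul, Matrix.conjTranspose_nonsing_inv,
      Matrix.conjTranspose_conjTranspose, Matrix.star_eq_conjTranspose,
      Matrix.conjTranspose_conjTranspose]
  -- `(Bᴴ)⁻¹` turns `P = Bᴴ B` into the identity, and a unitary change of basis preserves that.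
  refine ⟨star U * B.conjTranspose⁻¹, hS.eigenvalues, ?_, ?_⟩
  · rw [hconj, hB]
    calc star U * B.conjTranspose⁻¹ * (B.conjTranspose * B) * (B⁻¹ * U)
        = star U * ((B.conjTranspose⁻¹ * B.conjTranspose) * (B * B⁻¹)) * U := by
          simp only [Matrix.mul_assoc]
      _ = 1 := by
          rw [Matrix.nonsing_inv_mul _ hBu', Matrix.mul_nonsing_inv _ hBu, Matrix.one_mul,
            Matrix.mul_one, hU]
  · rw [hconj]
    have h := hS.conjStarAlgAut_star_eigenvectorUnitary
    rw [Unitary.conjStarAlgAut_star_apply] at h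
    refine Eq.trans ?_ h
    simp only [Matrix.mul_assoc, U]

/-! ### Whitening a circularly symmetric Gaussian vector -/

/-- The real part (`true`) or the imaginary part (`false`) of a complex number, as a continuous
real-linear map. -/
noncomputable def reim (b : Bool) : ℂ →L[ℝ] ℝ := cond b Complex.reCLM Complex.imCLM

theorem MeasureTheory.MemLp.reim {Ω : Type*} [MeasurableSpace Ω] {Q : Measure Ω} {x : Ω → ℂ}
    (hx : MemLp x 2 Q) (b : Bool) : MemLp (fun ω => reim b (x ω)) 2 Q :=
  (_root_.reim b).comp_memLp' hx

/-- If `E[x y] = 0` and `E[x ȳ] = c` is real, then the real and imaginary parts of `x` and `y` have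
mixed second moments `c / 2` (like parts) and `0` (unlike parts). -/
theorem integral_reim_mul_reim {Ω : Type*} [MeasurableSpace Ω] {Q : Measure Ω} {x y : Ω → ℂ}
    (hx : MemLp x 2 Q) (hy : MemLp y 2 Q) {c : ℝ} (hcov : ∫ ω, x ω * conj (y ω) ∂Q = c)
    (hpseudo : ∫ ω, x ω * y ω ∂Q = 0) (b b' : Bool) :
    ∫ ω, reim b (x ω) * reim b' (y ω) ∂Q = if b = b' then c / 2 else 0 := by
  have hI : ∀ b b', Integrable (fun ω => reim b (x ω) * reim b' (y ω)) Q := fun b b' =>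
    (hx.reim b).integrable_mul (hy.reim b')
  have hxy : Integrable (fun ω => x ω * conj (y ω)) Q := hx.integrable_mul_conj hy
  have hxy' : Integrable (fun ω => x ω * y ω) Q := hx.integrable_mul hy
  have h1 := congrArg Complex.re hcov
  have h2 := congrArg Complex.im hcov
  have h3 := congrArg Complex.re hpseudo
  have h4 := congrArg Complex.im hpseudo
  rw [← RCLike.re_eq_complex_re, ← integral_re hxy] at h1
  rw [← RCLike.im_eq_complex_im, ← integral_im hxy] at h2
  rw [← RCLike.re_eq_complex_re, ← integral_re hxy'] at h3
  rw [← RCLike.im_eq_complex_im, ← integral_im hxy'] at h4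
  simp only [RCLike.re_eq_complex_re, RCLike.im_eq_complex_im, Complex.mul_re, Complex.mul_im,
    Complex.conj_re, Complex.conj_im, Complex.ofReal_re, Complex.ofReal_im, Complex.zero_re,
    Complex.zero_im, mul_neg, sub_neg_eq_add] at h1 h2 h3 h4
  have itt : Integrable (fun ω => (x ω).re * (y ω).re) Q := hI true true
  have itf : Integrable (fun ω => (x ω).re * (y ω).im) Q := hI true false
  have ift : Integrable (fun ω => (x ω).im * (y ω).re) Q := hI false true
  have iff : Integrable (fun ω => (x ω).im * (y ω).im) Q := hI false false
  rw [integral_add itt iff] at h1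
  rw [integral_add itf.fun_neg ift, integral_neg] at h2
  rw [integral_sub itt iff] at h3
  rw [integral_add itf ift] at h4
  cases b <;> cases b' <;> simp [_root_.reim] <;> linarith

theorem ProbabilityTheory.HasGaussianLaw.sub_const {Ω E : Type*} [MeasurableSpace Ω]
    [NormedAddCommGroup E] [NormedSpace ℝ E] [MeasurableSpace E] [BorelSpace E] [CompleteSpace E]
    [SecondCountableTopology E] {Q : Measure Ω} {X : Ω → E}
    (hX : HasGaussianLaw X Q) (c : E) : HasGaussianLaw (fun ω => X ω - c) Q where
  isGaussian_map := by
    have := hX.isGaussian_map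
    have h : Q.map (fun ω => X ω - c) = (Q.map X).map (fun x => x - c) := by
      rw [AEMeasurable.map_map_of_aemeasurable (by fun_prop) hX.aemeasurable]; rfl
    rw [h]
    infer_instance

/-- The real or imaginary part of the `k`-th coordinate of `T (v - μ)`. -/
noncomputable def affineCoord {n : ℕ} (T : Matrix (Fin n) (Fin n) ℂ) (μ : Fin n → ℂ) (k : Fin n)
    (b : Bool) (v : Fin n → ℂ) : ℝ :=
  reim b (T.mulVec (v - μ) k)

section Whitening

variable {Ω : Type*} [MeasurableSpace Ω] {Q : Measure Ω} {n d : ℕ}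
  {μ : Fin n → ℂ} {P T : Matrix (Fin n) (Fin n) ℂ}

theorem HasComplexGaussianLaw.memLp {z : Ω → Fin n → ℂ} (hz : HasComplexGaussianLaw z μ P Q)
    (a : Fin n) : MemLp (fun ω => z ω a) 2 Q :=
  (ContinuousLinearMap.proj (R := ℝ) (φ := fun _ : Fin n => ℂ) a).comp_memLp' hz.gaussian.memLp_two

theorem HasComplexGaussianLaw.memLp_sub [IsFiniteMeasure Q] {z : Ω → Fin n → ℂ}
    (hz : HasComplexGaussianLaw z μ P Q) (a : Fin n) : MemLp (fun ω => (z ω - μ) a) 2 Q :=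
  (hz.memLp a).sub (memLp_const _)

theorem HasComplexGaussianLaw.secondMoment_sub {z : Ω → Fin n → ℂ}
    (hz : HasComplexGaussianLaw z μ P Q) :
    secondMoment (fun ω => z ω - μ) (fun ω => z ω - μ) Q = P := by
  ext a b
  exact hz.cov a b

/-- Whitening makes the coordinates uncorrelated, with unit covariance. -/
theorem HasComplexGaussianLaw.integral_mulVec_mul_conj [IsFiniteMeasure Q] {z : Ω → Fin n → ℂ}
    (hz : HasComplexGaussianLaw z μ P Q) (hT : T * P * T.conjTranspose = 1) (a b : Fin n) :
    ∫ ω, T.mulVec (z ω - μ) a * conj (T.mulVec (z ω - μ) b) ∂Q =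
      ((if a = b then 1 else 0 : ℝ) : ℂ) := by
  have h : secondMoment (fun ω => T.mulVec (z ω - μ)) (fun ω => T.mulVec (z ω - μ)) Q = 1 := by
    rw [secondMoment_mulVec_left T hz.memLp_sub (memLp_mulVec T hz.memLp_sub),
      secondMoment_mulVec_right T hz.memLp_sub hz.memLp_sub, hz.secondMoment_sub, ← mul_assoc, hT]
  refine (congrFun (congrFun h a) b).trans ?_
  rw [Matrix.one_apply]
  split_ifs <;> simp

/-- The pseudo-covariance of a linear image of a circularly symmetric vector vanishes. -/
theorem HasComplexGaussianLaw.integral_mulVec_mul [IsFiniteMeasure Q] {z : Ω → Fin n → ℂ}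
    (hz : HasComplexGaussianLaw z μ P Q) (a b : Fin n) :
    ∫ ω, T.mulVec (z ω - μ) a * T.mulVec (z ω - μ) b ∂Q = 0 := by
  -- The pseudo-covariance of `u` is the second-moment matrix of `u` and the conjugate of `u`.
  have hstar : ∀ a, MemLp (fun ω => (star (z ω - μ)) a) 2 Q := fun a => (hz.memLp_sub a).star
  have h0 : secondMoment (fun ω => z ω - μ) (fun ω => star (z ω - μ)) Q = 0 := by
    ext a b
    simpa [secondMoment] using hz.pseudoCov a b
  have h : secondMoment (fun ω => T.mulVec (z ω - μ))
      (fun ω => (T.map star).mulVec (star (z ω - μ))) Q = 0 := by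
    rw [secondMoment_mulVec_left T hz.memLp_sub (memLp_mulVec _ hstar),
      secondMoment_mulVec_right _ hz.memLp_sub hstar, h0, Matrix.zero_mul, Matrix.mul_zero]
  refine Eq.trans ?_ (congrFun (congrFun h a) b)
  refine integral_congr_ae (Filter.Eventually.of_forall fun ω => ?_)
  simp [Matrix.mulVec, dotProduct]

theorem HasComplexGaussianLaw.integral_mulVec [IsProbabilityMeasure Q] {z : Ω → Fin n → ℂ}
    (hz : HasComplexGaussianLaw z μ P Q) (b : Bool) (a : Fin n) :
    ∫ ω, reim b (T.mulVec (z ω - μ) a) ∂Q = 0 := by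
  have hint : ∀ j, Integrable (fun ω => z ω j) Q := fun j => (hz.memLp j).integrable one_le_two
  have hintT : Integrable (fun ω => T.mulVec (z ω - μ) a) Q :=
    (memLp_mulVec T hz.memLp_sub a).integrable one_le_two
  rw [(reim b).integral_comp_comm hintT]
  suffices h : ∫ ω, T.mulVec (z ω - μ) a ∂Q = 0 by rw [h, map_zero]
  simp only [Matrix.mulVec, dotProduct, Pi.sub_apply]
  have hsub : ∀ j, Integrable (fun ω => z ω j - μ j) Q := fun j =>
    (hint j).sub (integrable_const _)
  rw [integral_finsetSum _ fun j _ => (hsub j).const_mul _]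
  refine Finset.sum_eq_zero fun j _ => ?_
  rw [integral_const_mul, integral_sub (hint j) (integrable_const _), hz.mean j]
  simp

variable [IsProbabilityMeasure Q] {z : Fin d → Ω → Fin n → ℂ}

/-- Real and imaginary parts of the coordinates of independent whitened columns are jointly
Gaussian and pairwise uncorrelated, so independent. -/
theorem iIndepFun_whitened (hz : ∀ i, HasComplexGaussianLaw (z i) μ P Q) (hindep : iIndepFun z Q)
    (hT : T * P * T.conjTranspose = 1) :
    iIndepFun (fun (j : Fin d × Fin n × Bool) ω => affineCoord T μ j.2.1 j.2.2 (z j.1 ω)) Q := by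
  have hindep' : iIndepFun (fun i ω => z i ω - μ) Q :=
    hindep.comp (fun _ x => x - μ) fun _ => by fun_prop
  have hgauss : HasGaussianLaw (fun ω i => z i ω - μ) Q :=
    iIndepFun.hasGaussianLaw (fun i => (hz i).gaussian.sub_const μ) hindep'
  let W : Bool → Fin n → (Fin n → ℂ) →L[ℝ] ℝ := fun b k =>
    (reim b).comp ((ContinuousLinearMap.proj (R := ℝ) (φ := fun _ : Fin n => ℂ) k).comp
      ((LinearMap.toContinuousLinearMap T.mulVecLin).restrictScalars ℝ))
  let L : (Fin d → Fin n → ℂ) →L[ℝ] (Fin d × Fin n × Bool → ℝ) :=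
    ContinuousLinearMap.pi fun j => (W j.2.2 j.2.1).comp (ContinuousLinearMap.proj j.1)
  have hmem : ∀ j : Fin d × Fin n × Bool,
      MemLp (fun ω => reim j.2.2 (T.mulVec (z j.1 ω - μ) j.2.1)) 2 Q := fun j =>
    (memLp_mulVec T (hz j.1).memLp_sub j.2.1).reim _
  refine HasGaussianLaw.iIndepFun_of_covariance_eq_zero (hgauss.map L) fun j j' hjj' => ?_
  by_cases hi : j.1 = j'.1
  · obtain ⟨i, k, b⟩ := j
    obtain ⟨i', k', b'⟩ := j'
    obtain rfl : i = i' := hi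
    simp only [affineCoord]
    rw [covariance, (hz i).integral_mulVec, (hz i).integral_mulVec]
    simp only [sub_zero]
    rw [integral_reim_mul_reim (memLp_mulVec T (hz i).memLp_sub k)
      (memLp_mulVec T (hz i).memLp_sub k') ((hz i).integral_mulVec_mul_conj hT k k')
      ((hz i).integral_mulVec_mul k k')]
    split_ifs with h1 h2
    · exact absurd (by rw [h1, h2]) hjj'
    · simp
    · rfl
  · refine IndepFun.covariance_eq_zero ?_ (hmem j) (hmem j')
    exact (hindep'.indepFun hi).comp (W j.2.2 j.2.1).measurable (W j'.2.2 j'.2.1).measurable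

theorem HasComplexGaussianLaw.map_whitened {z : Ω → Fin n → ℂ} (hz : HasComplexGaussianLaw z μ P Q)
    (hT : T * P * T.conjTranspose = 1) (k : Fin n) (b : Bool) :
    Q.map (fun ω => affineCoord T μ k b (z ω)) = gaussianReal 0 (1 / 2) := by
  let W : (Fin n → ℂ) →L[ℝ] ℝ :=
    (reim b).comp ((ContinuousLinearMap.proj (R := ℝ) (φ := fun _ : Fin n => ℂ) k).comp
      ((LinearMap.toContinuousLinearMap T.mulVecLin).restrictScalars ℝ))
  have hlaw : HasGaussianLaw (fun ω => reim b (T.mulVec (z ω - μ) k)) Q :=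
    (hz.gaussian.sub_const μ).map W
  simp only [affineCoord]
  rw [hlaw.map_eq_gaussianReal, hz.integral_mulVec]
  congr 1
  rw [variance_of_integral_eq_zero hlaw.aemeasurable (hz.integral_mulVec b k)]
  simp only [sq]
  rw [integral_reim_mul_reim (memLp_mulVec T hz.memLp_sub k) (memLp_mulVec T hz.memLp_sub k)
    (hz.integral_mulVec_mul_conj hT k k) (hz.integral_mulVec_mul k k), if_pos rfl, if_pos rfl]
  ext
  simp

end Whitening

/-! ### The mutual-information bound -/

section MutualInfo

variable {Ω : Type*} [MeasurableSpace Ω] {Q : Measure Ω} {n m d : ℕ}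

theorem iIndepFun_map_of_comp {S ι β : Type*} [MeasurableSpace S] [MeasurableSpace β] [Fintype ι]
    [IsProbabilityMeasure Q] {z : Ω → S} (hz : AEMeasurable z Q) {φ : ι → S → β}
    (hφ : ∀ j, Measurable (φ j)) (h : iIndepFun (fun j => φ j ∘ z) Q) :
    iIndepFun φ (Q.map z) := by
  have hprob : IsProbabilityMeasure (Q.map z) := Measure.isProbabilityMeasure_map hz
  rw [iIndepFun_iff_map_fun_eq_pi_map fun j => (hφ j).comp_aemeasurable hz] at h
  rw [iIndepFun_iff_map_fun_eq_pi_map fun j => (hφ j).aemeasurable,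
    AEMeasurable.map_map_of_aemeasurable (by fun_prop) hz]
  refine h.trans (congrArg Measure.pi (funext fun j => ?_))
  rw [AEMeasurable.map_map_of_aemeasurable (hφ j).aemeasurable hz]

/-- Any affine estimators `A i (y_i - c i)` of the centred columns `z_i - μ`, and any error
variances `r k` in whitened coordinates, give a lower bound for the mutual information. -/
theorem le_mutualInfo_of_affine_estimator [IsProbabilityMeasure Q] {μ : Fin n → ℂ}
    {P T : Matrix (Fin n) (Fin n) ℂ} {Z : Ω → Matrix (Fin n) (Fin d) ℂ}
    {Y : Ω → Matrix (Fin m) (Fin d) ℂ}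
    (hZlaw : ∀ i, HasComplexGaussianLaw (fun ω => (Z ω).col i) μ P Q)
    (hZindep : iIndepFun (fun i ω => (Z ω).col i) Q)
    (hY : ∀ a i, MemLp (fun ω => Y ω a i) 2 Q) (hT : T * P * T.conjTranspose = 1)
    (A : Fin d → Matrix (Fin n) (Fin m) ℂ) (c : Fin d → Fin m → ℂ) {r : Fin n → ℝ}
    (hr : ∀ k, 0 < r k) {e : Fin d → Ω → Fin n → ℂ}
    (he : ∀ i ω, e i ω = ((Z ω).col i - μ) - (A i).mulVec ((Y ω).col i - c i)) :
    ((∑ i, ∑ k, (1 - Real.log (r k)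
      - ((T * secondMoment (e i) (e i) Q * T.conjTranspose) k k).re / r k) : ℝ) : EReal) ≤
      (mutualInfo Z Y Q : EReal) := by
  let z : Ω → Fin n → Fin d → ℂ := fun ω => Matrix.of.symm (Z ω)
  let y : Ω → Fin m → Fin d → ℂ := fun ω => Matrix.of.symm (Y ω)
  let φ : Fin d × Fin n × Bool → (Fin n → Fin d → ℂ) → ℝ := fun j s =>
    affineCoord T μ j.2.1 j.2.2 fun a => s a j.1
  let ψ : Fin d × Fin n × Bool → (Fin m → Fin d → ℂ) → ℝ := fun j t =>
    reim j.2.2 (T.mulVec ((A j.1).mulVec ((fun a => t a j.1) - c j.1)) j.2.1)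
  have hz : AEMeasurable z Q := aemeasurable_pi_lambda _ fun a => aemeasurable_pi_lambda _ fun i =>
    ((hZlaw i).memLp a).aestronglyMeasurable.aemeasurable
  have hy : AEMeasurable y Q := aemeasurable_pi_lambda _ fun a => aemeasurable_pi_lambda _ fun i =>
    (hY a i).aestronglyMeasurable.aemeasurable
  have hzy : AEMeasurable (fun ω => (z ω, y ω)) Q := hz.prodMk hy
  have hφ : ∀ j, Measurable (φ j) := fun j => by
    simp only [φ, affineCoord, Matrix.mulVec, dotProduct, Pi.sub_apply]
    fun_prop
  have hψ : ∀ j, Measurable (ψ j) := fun j => by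
    simp only [ψ, Matrix.mulVec, dotProduct, Pi.sub_apply]
    fun_prop
  have hlaw : ∀ j, (Q.map z).map (φ j) = gaussianReal 0 (1 / 2) := fun j => by
    rw [AEMeasurable.map_map_of_aemeasurable (hφ j).aemeasurable hz]
    exact (hZlaw j.1).map_whitened hT j.2.1 j.2.2
  have hκ : IsProbabilityMeasure (Q.map z) := Measure.isProbabilityMeasure_map hz
  have hτ : IsProbabilityMeasure (Q.map y) := Measure.isProbabilityMeasure_map hy
  have hπ : IsProbabilityMeasure (Q.map fun ω => (z ω, y ω)) :=
    Measure.isProbabilityMeasure_map hzy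
  have hindep : iIndepFun φ (Q.map z) :=
    iIndepFun_map_of_comp hz hφ
      (iIndepFun_whitened (z := fun i ω => (Z ω).col i) (T := T) hZlaw hZindep hT)
  have heL : ∀ i a, MemLp (fun ω => e i ω a) 2 Q := fun i a => by
    simp only [he]
    exact ((hZlaw i).memLp_sub a).sub
      (memLp_mulVec (A i) (fun b => (hY b i).sub (memLp_const (c i b))) a)
  have hTe : ∀ i a, MemLp (fun ω => T.mulVec (e i ω) a) 2 Q := fun i => memLp_mulVec T (heL i)
  have hTz : ∀ i a, MemLp (fun ω => T.mulVec ((Z ω).col i - μ) a) 2 Q := fun i =>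
    memLp_mulVec T (hZlaw i).memLp_sub
  have herr : ∀ j ω, φ j (z ω) - ψ j (y ω) = reim j.2.2 (T.mulVec (e j.1 ω) j.2.1) := fun j ω => by
    rw [he, Matrix.mulVec_sub T, Pi.sub_apply, map_sub]
    rfl
  have hφm : ∀ j, Measurable fun p : (Fin n → Fin d → ℂ) × (Fin m → Fin d → ℂ) => φ j p.1 ^ 2 :=
    fun j => by fun_prop
  have hφψm : ∀ j, Measurable fun p : (Fin n → Fin d → ℂ) × (Fin m → Fin d → ℂ) =>
      (φ j p.1 - ψ j p.2) ^ 2 := fun j => by fun_prop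
  have key := integral_gaussian_test_le_klDiv (Q.map fun ω => (z ω, y ω)) (Q.map z) (Q.map y)
    hφ hψ hindep hlaw (r := fun j => r j.2.1) (fun j => hr _)
    (fun j => by
      rw [integrable_map_measure (hφm j).aestronglyMeasurable hzy]
      exact ((hTz j.1 j.2.1).reim j.2.2).integrable_sq)
    (fun j => by
      rw [integrable_map_measure (hφψm j).aestronglyMeasurable hzy]
      simp only [Function.comp_def, herr]
      exact ((hTe j.1 j.2.1).reim j.2.2).integrable_sq)
  refine Eq.trans_le ?_ key
  congr 1
  simp only [Fintype.sum_prod_type, Fintype.sum_bool]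
  refine Finset.sum_congr rfl fun i _ => Finset.sum_congr rfl fun k _ => ?_
  have h1 : ∀ b, ∫ p, φ (i, k, b) p.1 ^ 2 ∂(Q.map fun ω => (z ω, y ω)) = 1 / 2 := fun b => by
    rw [integral_map hzy (hφm _).aestronglyMeasurable]
    have h := integral_reim_mul_reim (hTz i k) (hTz i k)
      ((hZlaw i).integral_mulVec_mul_conj hT k k) ((hZlaw i).integral_mulVec_mul k k) b b
    rw [if_pos rfl, if_pos rfl] at h
    simp only [sq]
    exact h
  have h2 : ∀ b, ∫ p, (φ (i, k, b) p.1 - ψ (i, k, b) p.2) ^ 2 ∂(Q.map fun ω => (z ω, y ω)) =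
      ∫ ω, reim b (T.mulVec (e i ω) k) ^ 2 ∂Q := fun b => by
    rw [integral_map hzy (hφψm _).aestronglyMeasurable]
    simp only [herr]
  have h3 := congrArg Complex.re (secondMoment_self_apply_self k (hTe i k))
  rw [secondMoment_mulVec_left T (heL i) (hTe i), secondMoment_mulVec_right T (heL i) (heL i),
    ← Matrix.mul_assoc, Complex.ofReal_re] at h3
  rw [h1, h1, h2, h2, h3, add_div]
  simp only [reim, cond_true, cond_false, Complex.reCLM_apply, Complex.imCLM_apply]
  ring

/-- If `-d log ∏ (ρ k + ε)` is a lower bound for every `ε > 0`, so is its limit at `ε = 0`, where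
the product may vanish and the logarithm be infinite. -/
theorem neg_mul_log_prod_le_of_forall_pos {ρ : Fin n → ℝ} (hρ : ∀ k, 0 ≤ ρ k) {b : EReal}
    (h : ∀ ε : ℝ, 0 < ε → ((-(d : ℝ) * ∑ k, Real.log (ρ k + ε) : ℝ) : EReal) ≤ b) :
    -(d : EReal) * ENNReal.log (ENNReal.ofReal (∏ k, ρ k)) ≤ b := by
  have hcont : Continuous fun ε : ℝ => ENNReal.log (ENNReal.ofReal (∏ k, (ρ k + ε))) :=
    ENNReal.continuous_log.comp (ENNReal.continuous_ofReal.comp (by fun_prop))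
  have hd : (-(d : EReal)) = ((-(d : ℝ) : ℝ) : EReal) := by simp
  have hlim := (hcont.tendsto 0).mono_left (nhdsWithin_le_nhds (s := Set.Ioi 0))
  simp only [add_zero] at hlim
  have hlim' := EReal.Tendsto.const_mul (a := -(d : EReal)) hlim
    (Or.inl (hd ▸ EReal.coe_ne_bot _)) (Or.inl (hd ▸ EReal.coe_ne_top _))
  refine le_of_tendsto hlim' (eventually_nhdsWithin_of_forall fun ε (hε : 0 < ε) => ?_)
  have hpos : ∀ k, 0 < ρ k + ε := fun k => add_pos_of_nonneg_of_pos (hρ k) hε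
  refine le_trans (le_of_eq ?_) (h ε hε)
  rw [ENNReal.log_ofReal_of_pos (Finset.prod_pos fun k _ => hpos k),
    Real.log_prod fun k _ => (hpos k).ne', hd, EReal.coe_mul]

theorem explainedCov_isHermitian (Z : Ω → Matrix (Fin n) (Fin d) ℂ)
    (Y : Ω → Matrix (Fin m) (Fin d) ℂ) (i : Fin d) : (explainedCov Z Y Q i).IsHermitian := by
  simp only [explainedCov, crossCov_eq_secondMoment, Matrix.IsHermitian, Matrix.conjTranspose_mul,
    Matrix.conjTranspose_nonsing_inv, conjTranspose_secondMoment, Matrix.mul_assoc]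

end MutualInfo

theorem mainTheorem5 {Ω : Type*} [MeasurableSpace Ω] (Q : Measure Ω) [IsProbabilityMeasure Q]
    {n m d : ℕ} (hd : 0 < d)
    (μ : Fin n → ℂ) (P : Matrix (Fin n) (Fin n) ℂ) (hP : P.PosDef)
    (Z : Ω → Matrix (Fin n) (Fin d) ℂ) (Y : Ω → Matrix (Fin m) (Fin d) ℂ)
    (hZlaw : ∀ i, HasComplexGaussianLaw (fun ω => (Z ω).col i) μ P Q)
    (hZindep : iIndepFun (fun i ω => (Z ω).col i) Q)
    (hY : ∀ a i, MemLp (fun ω => Y ω a i) 2 Q)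
    (hYinv : ∀ i, IsUnit (crossCov (fun ω => (Y ω).col i) (fun ω => (Y ω).col i) Q)) :
    (1 - corrMatrix P Z Y Q).det.im = 0 ∧ 0 ≤ (1 - corrMatrix P Z Y Q).det.re ∧
      -(d : EReal) * ENNReal.log (ENNReal.ofReal (1 - corrMatrix P Z Y Q).det.re) ≤
        (mutualInfo Z Y Q : EReal) := by
  have hd0 : (d : ℝ) ≠ 0 := by exact_mod_cast hd.ne'
  have hd0' : (d : ℂ) ≠ 0 := by exact_mod_cast hd.ne'
  let R : Matrix (Fin n) (Fin n) ℂ := P - (1 / (d : ℂ)) • ∑ i, explainedCov Z Y Q i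
  have hR : R.IsHermitian := by
    refine hP.isHermitian.sub ?_
    rw [Matrix.IsHermitian, Matrix.conjTranspose_smul, Matrix.conjTranspose_sum]
    simp [(explainedCov_isHermitian Z Y _).eq]
  obtain ⟨T, ρ, hTP, hTR⟩ := hP.exists_congruence_diagonal hR
  let c : Fin d → Fin m → ℂ := fun i a => ∫ ω, Y ω a i ∂Q
  let A : Fin d → Matrix (Fin n) (Fin m) ℂ := fun i =>
    crossCov (fun ω => (Z ω).col i) (fun ω => (Y ω).col i) Q *
      (crossCov (fun ω => (Y ω).col i) (fun ω => (Y ω).col i) Q)⁻¹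
  let e : Fin d → Ω → Fin n → ℂ := fun i ω =>
    ((Z ω).col i - μ) - (A i).mulVec ((Y ω).col i - c i)
  have herr : ∀ i, secondMoment (e i) (e i) Q = P - explainedCov Z Y Q i := fun i => by
    have hZc : (fun ω a => (Z ω).col i a - ∫ ω', (Z ω').col i a ∂Q) =
        fun ω => (Z ω).col i - μ := by
      funext ω a
      rw [(hZlaw i).mean a]
      rfl
    have hA : A i = secondMoment (fun ω => (Z ω).col i - μ) (fun ω => (Y ω).col i - c i) Q *
        (secondMoment (fun ω => (Y ω).col i - c i) (fun ω => (Y ω).col i - c i) Q)⁻¹ := by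
      simp only [A, crossCov_eq_secondMoment, hZc]
      rfl
    have h := secondMoment_sub_lmmse (hZlaw i).memLp_sub
      (fun a => (hY a i).sub (memLp_const (c i a))) (hYinv i) hA
    refine h.trans ?_
    rw [(hZlaw i).secondMoment_sub]
    simp only [explainedCov, crossCov_eq_secondMoment, hZc]
    rfl
  have hsum : ∑ i, secondMoment (e i) (e i) Q = (d : ℂ) • R := by
    simp only [herr, R, Finset.sum_sub_distrib, smul_sub, smul_smul, mul_one_div_cancel hd0',
      one_smul, Finset.sum_const, Finset.card_univ, Fintype.card_fin, Nat.cast_smul_eq_nsmul]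
  -- `ρ k` is the mean over the columns of the error variance of the `k`-th whitened coordinate.
  have hρsum : ∀ k, ∑ i, ((T * secondMoment (e i) (e i) Q * T.conjTranspose) k k).re = d * ρ k := by
    intro k
    rw [← Complex.re_sum, ← Matrix.sum_apply, ← Finset.sum_mul, ← Finset.mul_sum, hsum,
      Matrix.mul_smul, Matrix.smul_mul, hTR]
    simp
  have hρ : ∀ k, 0 ≤ ρ k := fun k => by
    have heL : ∀ i a, MemLp (fun ω => e i ω a) 2 Q := fun i a =>
      ((hZlaw i).memLp_sub a).sub
        (memLp_mulVec (A i) (fun b => (hY b i).sub (memLp_const (c i b))) a)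
    refine nonneg_of_mul_nonneg_right (a := (d : ℝ)) ?_ (by exact_mod_cast hd)
    rw [← hρsum k]
    refine Finset.sum_nonneg fun i _ => ?_
    rw [Matrix.mul_assoc, ← secondMoment_mulVec_right T (heL i) (heL i),
      ← secondMoment_mulVec_left T (heL i) (memLp_mulVec T (heL i)),
      secondMoment_self_apply_self k (memLp_mulVec T (heL i) k), Complex.ofReal_re]
    positivity
  have hPdet : IsUnit P.det := isUnit_iff_ne_zero.2 hP.det_pos.ne'
  have hdet : (1 - corrMatrix P Z Y Q).det = ((∏ k, ρ k : ℝ) : ℂ) := by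
    have h1 : 1 - corrMatrix P Z Y Q = P⁻¹ * R := by
      rw [Matrix.mul_sub, Matrix.nonsing_inv_mul _ hPdet]
      rfl
    have h2 := congrArg Matrix.det hTP
    have h3 := congrArg Matrix.det hTR
    have h4 := congrArg Matrix.det (Matrix.nonsing_inv_mul P hPdet)
    simp only [Matrix.det_mul, Matrix.det_one, Matrix.det_diagonal] at h2 h3 h4
    rw [h1, Matrix.det_mul, Complex.ofReal_prod, ← h3]
    linear_combination (-(P⁻¹.det * R.det)) * h2 + T.det * R.det * T.conjTranspose.det * h4
  rw [hdet, Complex.ofReal_re, Complex.ofReal_im]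
  refine ⟨rfl, Finset.prod_nonneg fun k _ => hρ k,
    neg_mul_log_prod_le_of_forall_pos hρ fun ε hε => ?_⟩
  have hpos : ∀ k, 0 < ρ k + ε := fun k => add_pos_of_nonneg_of_pos (hρ k) hε
  refine le_trans (EReal.coe_le_coe_iff.2 ?_) (le_mutualInfo_of_affine_estimator hZlaw hZindep hY
    hTP A c hpos (e := e) fun i ω => rfl)
  rw [Finset.sum_comm, Finset.mul_sum]
  refine Finset.sum_le_sum fun k _ => ?_
  rw [Finset.sum_sub_distrib, ← Finset.sum_div, hρsum k, Finset.sum_const, Finset.card_univ,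
    Fintype.card_fin, nsmul_eq_mul]
  -- The gain `1` exceeds the cost `ρ k / (ρ k + ε)`, and only the logarithm remains.
  have hle : d * ρ k / (ρ k + ε) ≤ (d : ℝ) := by
    rw [div_le_iff₀ (hpos k)]
    exact mul_le_mul_of_nonneg_left (by linarith) (Nat.cast_nonneg d)
  linarith
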